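/- Let $d\ge 1$, $2\le p<\infty$ and $s\in\mathbb R$. Let $\chi_0\in C_c^\infty(B(0,2))$ be a radially decreasing real function on $\mathbb R^d$ with $\chi_0(\xi)=1$ for $|\xi|\le 1$, and put $\chi(\xi)=\chi_0(\xi/2)-\chi_0(\xi)$ and $\chi_N(\xi)=\chi(\xi/N)$ for $N\in 2^{\mathbb N_0}$. For $m\in 2^{\mathbb Z}\cup\{0\}$ and a Schwartz function $f$ on $\mathbb R^d$, with $\hat f(\xi)=\int e^{-ix\cdot\xi}f(x)\,dx$, let $$S_{m^2,N}f(x,t)=\int_{\mathbb R^d}e^{i(x\cdot\xi+t\sqrt{|\xi|^2+m^2})}\chi_N(\xi)\hat f(\xi)\,d\xi .$$ For a set $M\subseteq 2^{\mathbb Z}\cup\{0\}$ consider the statement that there is a constant $C<\infty$ with $$\|S_{m^2,N}f\|_{L^p_{t,x}([0,1]\times\mathbb R^d)}\le C\,N^s\,\|f\|_{L^p(\mathbb R^d)}\qquad\text{for all } N\in 2^{\mathbb N_0},\ m\in M,\ f\in\mathcal S(\mathbb R^d).\tag{$*$}$$ (i) If $(*)$ holds for $M=2^{\mathbb Z}\cup\{0\}$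 (that is, uniformly in $N$ and $m$), then $s\ge\max\big(d(\tfrac12-\tfrac1p)-\tfrac1p,\,0\big)$. (ii) Let $m_0\in\mathbb R$. If $(*)$ holds for some nonempty $M\subseteq\{m\in 2^{\mathbb Z}\cup\{0\}: m\le m_0\}$ (for instance for a single mass $m\le m_0$ uniformly in $N$, or uniformly in $N$ and all $m\le m_0$), with $C$ allowed to depend on $m_0$ and $M$, then $s\ge\max\big((d-1)(\tfrac12-\tfrac1p)-\tfrac1p,\,0\big)$. -/

import Mathlib

open scoped FourierTransform ContDiff NNReal ENNReal SchwartzMap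
open MeasureTheory

namespace KleinGordon

noncomputable section

/-- Fourier transform of a Schwartz function in the normalization
`f̂(ξ) = ∫ e^{-i x · ξ} f(x) dx`, which matches the phase `e^{i x · ξ}` of the propagator.
Mathlib's `𝓕` has the kernel `e^{-2 π i x · ξ}`; see `fourierHat_eq_integral`. -/
def fourierHat {d : ℕ} (f : 𝓢(EuclideanSpace ℝ (Fin d), ℂ)) (ξ : EuclideanSpace ℝ (Fin d)) : ℂ :=
  𝓕 (f : EuclideanSpace ℝ (Fin d) → ℂ) ((2 * Real.pi)⁻¹ • ξ)

theorem fourierHat_eq_integral {d : ℕ} (f : 𝓢(EuclideanSpace ℝ (Fin d), ℂ))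
    (ξ : EuclideanSpace ℝ (Fin d)) :
    fourierHat f ξ = ∫ x, Complex.exp (-(Complex.I * (inner ℝ x ξ : ℝ))) * f x := by
  rw [fourierHat, Real.fourier_eq']
  refine integral_congr_ae (Filter.Eventually.of_forall fun x => ?_)
  have h : (-2 * Real.pi * inner ℝ x ((2 * Real.pi)⁻¹ • ξ) : ℝ) = -inner ℝ x ξ := by
    rw [inner_smul_right]
    field_simp
  simp only [h, smul_eq_mul]
  congr 2
  push_cast
  ring

/-- A radially decreasing `χ₀ ∈ C_c^∞(B(0,2))` with `χ₀ = 1` on `{|ξ| ≤ 1}`. -/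
structure IsRadialCutoff {d : ℕ} (χ₀ : EuclideanSpace ℝ (Fin d) → ℝ) : Prop where
  contDiff : ContDiff ℝ ∞ χ₀
  tsupport_subset : tsupport χ₀ ⊆ Metric.ball 0 2
  eq_one : ∀ ξ, ‖ξ‖ ≤ 1 → χ₀ ξ = 1
  radially_decreasing : ∀ ξ η, ‖ξ‖ ≤ ‖η‖ → χ₀ η ≤ χ₀ ξ

/-- `χ(ξ) = χ₀(ξ/2) - χ₀(ξ)`. -/
def annulusCutoff {d : ℕ} (χ₀ : EuclideanSpace ℝ (Fin d) → ℝ) (ξ : EuclideanSpace ℝ (Fin d)) : ℝ :=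
  χ₀ ((2 : ℝ)⁻¹ • ξ) - χ₀ ξ

/-- `χ_N(ξ) = χ(ξ/N)`. -/
def dyadicCutoff {d : ℕ} (χ₀ : EuclideanSpace ℝ (Fin d) → ℝ) (N : ℝ)
    (ξ : EuclideanSpace ℝ (Fin d)) : ℝ :=
  annulusCutoff χ₀ (N⁻¹ • ξ)

/-- `S_{m²,N} f(x,t) = ∫ e^{i (x · ξ + t √(|ξ|² + m²))} χ_N(ξ) f̂(ξ) dξ`. -/
def propagator {d : ℕ} (χ₀ : EuclideanSpace ℝ (Fin d) → ℝ) (m N : ℝ)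
    (f : 𝓢(EuclideanSpace ℝ (Fin d), ℂ)) (x : EuclideanSpace ℝ (Fin d)) (t : ℝ) : ℂ :=
  ∫ ξ, Complex.exp (Complex.I * ((inner ℝ x ξ + t * √(‖ξ‖ ^ 2 + m ^ 2) : ℝ) : ℂ)) *
    (dyadicCutoff χ₀ N ξ : ℂ) * fourierHat f ξ

/-- The admissible masses `2^ℤ ∪ {0}`. -/
def masses : Set ℝ := {m | m = 0 ∨ ∃ j : ℤ, m = (2 : ℝ) ^ j}

/-- The estimate `‖S_{m²,N} f‖_{L^p([0,1] × ℝ^d)} ≤ C N^s ‖f‖_{L^p}` for Schwartz `f`, with one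
constant `C` for all `N ∈ 2^{ℕ₀}` and all `m ∈ M`. -/
def LocalSmoothing {d : ℕ} (χ₀ : EuclideanSpace ℝ (Fin d) → ℝ) (p s : ℝ) (M : Set ℝ) : Prop :=
  ∃ C : ℝ≥0, ∀ k : ℕ, ∀ m ∈ M, ∀ f : 𝓢(EuclideanSpace ℝ (Fin d), ℂ),
    eLpNorm (fun z : ℝ × EuclideanSpace ℝ (Fin d) => propagator χ₀ m ((2 : ℝ) ^ k) f z.2 z.1)
        (ENNReal.ofReal p) (volume.restrict (Set.Icc (0 : ℝ) 1 ×ˢ Set.univ))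
      ≤ C * ENNReal.ofReal (((2 : ℝ) ^ k) ^ s) * eLpNorm f (ENNReal.ofReal p) volume

end

end KleinGordon

/-!
The exponents are forced by three explicit families of data, all built from wave packets. A packet
is the function with Fourier transform `e^{-i(a + v · ξ)} β(A⁻¹(ξ - ξ₀))`, for a fixed bump `β` and a
symmetric linear map `A`; on the physical side its modulus is the rescaled bump
`|det A| |g(A(x - v))|` concentrated near `v` (`norm_packet`).

If, on the support of the packet, the dispersion relation `φ(ξ) = √(|ξ|² + m²)` is within `1/2` of
the affine function `a + v · ξ`, then the packet travels with velocity `-v` and reaches the origin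
at time `1`. A superposition of packets with many different velocities therefore focuses: for
`|x|, 1 - t ≲ 1/N` all integrands are almost positive, so no cancellation occurs and the solution is
as large as the sum of the packets (`le_norm_propagator_sum_packet`). At time `0`, on the other
hand, the packets sit at the points `v`. If these are separated by the width of a packet, the sum of
the moduli is comparable to one packet's supremum (`exists_sum_norm_le`), and interpolating this
supremum bound with the triangle inequality in `L¹` bounds the `L^p` norm of the data. The
resulting inequality is `LocalSmoothing.exists_packet_bound`. Parametrizing the packets by their
velocities makes the overlap estimate a lattice sum, and no stationary phase is needed.

With `N = R²`, the three choices are the following.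

* For `s ≥ 0`: one packet of unit scale (`LocalSmoothing.nonneg`).
* For all masses: `m = N`, where the Hessian of `φ` has full rank and size `1/N`, so that `φ` is
  affine up to `O(1)` on balls of radius `R`. There are `R^d` packets, of width `1/R`, with velocities
  in a cube of `ℝ^d` (`LocalSmoothing.le_of_large_masses`).
* For a fixed mass: `φ(ξ)` is close to `|ξ|`, which is linear up to `O(1)` on plates of length `R²`
  and width `R`. There are `R^(d-1)` packets, with velocities in a cap of the unit sphere
  (`LocalSmoothing.le_of_mem`).
-/

namespace KleinGordon

/-! ### Stretchings along a direction -/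

/-- The symmetric map scaling the direction `θ` by `S` and its orthogonal complement by `R`. -/
theorem exists_stretch {d : ℕ} {θ : EuclideanSpace ℝ (Fin d)} (hθ : ‖θ‖ = 1) {R S : ℝ}
    (hR : 0 < R) (hS : 0 < S) :
    ∃ A : EuclideanSpace ℝ (Fin d) ≃L[ℝ] EuclideanSpace ℝ (Fin d),
      (∀ x, A x = R • x + ((S - R) * inner ℝ θ x) • θ) ∧
      LinearMap.det (A : EuclideanSpace ℝ (Fin d) →ₗ[ℝ] EuclideanSpace ℝ (Fin d)) =
        R ^ d * (S / R) := by
  set T : EuclideanSpace ℝ (Fin d) →ₗ[ℝ] EuclideanSpace ℝ (Fin d) :=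
    R • LinearMap.transvection (innerₗ _ θ) ((S / R - 1) • θ) with hT
  have hTx : ∀ x, T x = R • x + ((S - R) * inner ℝ θ x) • θ := by
    intro x
    simp only [hT, LinearMap.smul_apply, LinearMap.transvection.apply, innerₗ_apply_apply,
      smul_add, smul_smul]
    congr 2
    field_simp
  have hdet : LinearMap.det T = R ^ d * (S / R) := by
    rw [hT, LinearMap.det_smul, LinearMap.transvection.det]
    simp [hθ]
  have hne : LinearMap.det T ≠ 0 := by rw [hdet]; positivity
  refine ⟨(T.equivOfDetNeZero hne).toContinuousLinearEquiv, fun x => ?_, ?_⟩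
  · rw [← hTx]; rfl
  · rw [← hdet]; rfl

section Stretch

variable {d : ℕ} {θ : EuclideanSpace ℝ (Fin d)} {R S : ℝ}
  {A : EuclideanSpace ℝ (Fin d) ≃L[ℝ] EuclideanSpace ℝ (Fin d)}

theorem inner_stretch_comm (hA : ∀ x, A x = R • x + ((S - R) * inner ℝ θ x) • θ)
    (x y : EuclideanSpace ℝ (Fin d)) : inner ℝ (A x) y = inner ℝ x (A y) := by
  simp only [hA, inner_add_left, inner_add_right, real_inner_smul_left, real_inner_smul_right,
    real_inner_comm θ x]
  ring

theorem norm_stretch_sq (hθ : ‖θ‖ = 1) (hA : ∀ x, A x = R • x + ((S - R) * inner ℝ θ x) • θ)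
    (x : EuclideanSpace ℝ (Fin d)) :
    ‖A x‖ ^ 2 = R ^ 2 * ‖x‖ ^ 2 + (S ^ 2 - R ^ 2) * (inner ℝ θ x) ^ 2 := by
  rw [hA, norm_add_sq_real, norm_smul, norm_smul, hθ, real_inner_smul_left,
    real_inner_smul_right, real_inner_comm θ x, mul_pow, mul_one, Real.norm_eq_abs,
    Real.norm_eq_abs, sq_abs, sq_abs]
  ring

theorem inner_stretch (hθ : ‖θ‖ = 1) (hA : ∀ x, A x = R • x + ((S - R) * inner ℝ θ x) • θ)
    (x : EuclideanSpace ℝ (Fin d)) : inner ℝ θ (A x) = S * inner ℝ θ x := by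
  rw [hA, inner_add_right, real_inner_smul_right, real_inner_smul_right,
    real_inner_self_eq_norm_sq, hθ]
  ring

theorem inner_sq_le_norm_sq (hθ : ‖θ‖ = 1) (x : EuclideanSpace ℝ (Fin d)) :
    (inner ℝ θ x) ^ 2 ≤ ‖x‖ ^ 2 := by
  have h := abs_real_inner_le_norm θ x
  rw [hθ, one_mul] at h
  exact sq_le_sq' (abs_le.1 h).1 (abs_le.1 h).2

theorem le_norm_stretch (hθ : ‖θ‖ = 1) (hR : 0 < R) (hRS : R ≤ S)
    (hA : ∀ x, A x = R • x + ((S - R) * inner ℝ θ x) • θ) (x : EuclideanSpace ℝ (Fin d)) :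
    R * ‖x‖ ≤ ‖A x‖ := by
  refine le_of_sq_le_sq ?_ (norm_nonneg _)
  rw [norm_stretch_sq hθ hA, mul_pow]
  have : 0 ≤ S ^ 2 - R ^ 2 := by nlinarith
  have := mul_nonneg this (sq_nonneg (inner ℝ θ x))
  linarith

theorem norm_stretch_le (hθ : ‖θ‖ = 1) (hR : 0 < R) (hRS : R ≤ S)
    (hA : ∀ x, A x = R • x + ((S - R) * inner ℝ θ x) • θ) (x : EuclideanSpace ℝ (Fin d)) :
    ‖A x‖ ≤ S * ‖x‖ := by
  refine le_of_sq_le_sq ?_ (mul_nonneg (hR.le.trans hRS) (norm_nonneg _))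
  rw [norm_stretch_sq hθ hA, mul_pow]
  have h1 : 0 ≤ S ^ 2 - R ^ 2 := by nlinarith
  have := mul_le_mul_of_nonneg_left (inner_sq_le_norm_sq hθ x) h1
  linarith

end Stretch

/-! ### Affine changes of variables -/

section ChangeOfVariables

variable {d : ℕ} (A : EuclideanSpace ℝ (Fin d) ≃L[ℝ] EuclideanSpace ℝ (Fin d))

theorem map_affine_volume (c : EuclideanSpace ℝ (Fin d)) :
    ENNReal.ofReal |LinearMap.det (A : EuclideanSpace ℝ (Fin d) →ₗ[ℝ] EuclideanSpace ℝ (Fin d))| •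
      Measure.map (fun x => A x + c) (volume : Measure (EuclideanSpace ℝ (Fin d))) = volume := by
  have hne : LinearMap.det (A : EuclideanSpace ℝ (Fin d) →ₗ[ℝ] EuclideanSpace ℝ (Fin d)) ≠ 0 :=
    (LinearEquiv.isUnit_det' A.toLinearEquiv).ne_zero
  have h1 : Measure.map (fun x => A x + c) (volume : Measure (EuclideanSpace ℝ (Fin d))) =
      Measure.map (fun x => x + c) (Measure.map
        (A : EuclideanSpace ℝ (Fin d) →ₗ[ℝ] EuclideanSpace ℝ (Fin d)) volume) := by
    rw [Measure.map_map (by fun_prop) (by exact A.continuous.measurable)]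
    rfl
  rw [h1, Measure.map_linearMap_addHaar_eq_smul_addHaar _ hne, Measure.map_smul,
    map_add_right_eq_self, smul_smul, ← ENNReal.ofReal_mul (abs_nonneg _), ← abs_mul,
    mul_inv_cancel₀ hne, abs_one, ENNReal.ofReal_one, one_smul]

theorem measurableEmbedding_affine (c : EuclideanSpace ℝ (Fin d)) :
    MeasurableEmbedding (fun x => A x + c) :=
  ((A.toHomeomorph.trans (Homeomorph.addRight c))).measurableEmbedding

theorem integral_eq_abs_det_mul_integral_affine {F : Type*} [NormedAddCommGroup F]
    [NormedSpace ℝ F] (c : EuclideanSpace ℝ (Fin d)) (f : EuclideanSpace ℝ (Fin d) → F) :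
    ∫ x, f x =
      |LinearMap.det (A : EuclideanSpace ℝ (Fin d) →ₗ[ℝ] EuclideanSpace ℝ (Fin d))| •
        ∫ x, f (A x + c) := by
  conv_lhs => rw [← map_affine_volume A c]
  rw [integral_smul_measure, (measurableEmbedding_affine A c).integral_map,
    ENNReal.toReal_ofReal (abs_nonneg _)]

theorem lintegral_eq_abs_det_mul_lintegral_affine (c : EuclideanSpace ℝ (Fin d))
    (f : EuclideanSpace ℝ (Fin d) → ℝ≥0∞) :
    ∫⁻ x, f x =
      ENNReal.ofReal
        |LinearMap.det (A : EuclideanSpace ℝ (Fin d) →ₗ[ℝ] EuclideanSpace ℝ (Fin d))| *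
        ∫⁻ x, f (A x + c) := by
  conv_lhs => rw [← map_affine_volume A c]
  rw [lintegral_smul_measure, (measurableEmbedding_affine A c).lintegral_map, smul_eq_mul]

end ChangeOfVariables

/-! ### Wave packets -/

section Packet

variable {d : ℕ} (β : ContDiffBump (0 : EuclideanSpace ℝ (Fin d)))
  (A : EuclideanSpace ℝ (Fin d) ≃L[ℝ] EuclideanSpace ℝ (Fin d))
  (ξ₀ v : EuclideanSpace ℝ (Fin d)) (a : ℝ)

/-- The Fourier side of a wave packet: the bump `β` transported to the ellipsoid `ξ₀ + A (supp β)`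
and modulated by the affine phase `-(a + v · ξ)`. -/
noncomputable def packetHat (ξ : EuclideanSpace ℝ (Fin d)) : ℂ :=
  Complex.exp (-(Complex.I * ((a + inner ℝ v ξ : ℝ) : ℂ))) * (β (A.symm (ξ - ξ₀)) : ℂ)

theorem contDiff_packetHat : ContDiff ℝ ∞ (packetHat β A ξ₀ v a) := by
  unfold packetHat
  have h1 : ContDiff ℝ ∞ fun ξ => β (A.symm (ξ - ξ₀)) := β.contDiff.comp (by fun_prop)
  have h2 : ContDiff ℝ ∞ fun ξ : EuclideanSpace ℝ (Fin d) => ((a + inner ℝ v ξ : ℝ) : ℂ) :=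
    Complex.ofRealCLM.contDiff.comp (contDiff_const.add (contDiff_const.inner ℝ contDiff_id))
  have h3 : ContDiff ℝ ∞ fun ξ => ((β (A.symm (ξ - ξ₀)) : ℝ) : ℂ) :=
    Complex.ofRealCLM.contDiff.comp h1
  fun_prop

theorem hasCompactSupport_bump_affine :
    HasCompactSupport fun ξ => β (A.symm (ξ - ξ₀)) :=
  β.hasCompactSupport.comp_homeomorph ((Homeomorph.subRight ξ₀).trans A.symm.toHomeomorph)

theorem integral_bump_affine :
    ∫ ξ, β (A.symm (ξ - ξ₀)) =
      |LinearMap.det (A : EuclideanSpace ℝ (Fin d) →ₗ[ℝ] EuclideanSpace ℝ (Fin d))| *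
        ∫ ξ, β ξ := by
  rw [integral_eq_abs_det_mul_integral_affine A ξ₀]
  simp

theorem hasCompactSupport_packetHat : HasCompactSupport (packetHat β A ξ₀ v a) := by
  refine (hasCompactSupport_bump_affine β A ξ₀).mono fun ξ hξ => ?_
  rw [Function.mem_support] at hξ ⊢
  intro h
  exact hξ (by rw [packetHat, h]; simp)

/-- The wave packet whose Fourier transform `fourierHat` is `packetHat`. -/
noncomputable def packet : 𝓢(EuclideanSpace ℝ (Fin d), ℂ) :=
  𝓕⁻ (HasCompactSupport.toSchwartzMap
    (f := fun ζ => packetHat β A ξ₀ v a ((2 * Real.pi) • ζ))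
    ((hasCompactSupport_packetHat β A ξ₀ v a).comp_smul (by positivity))
    ((contDiff_packetHat β A ξ₀ v a).comp (by fun_prop)))

theorem fourierHat_packet (ξ : EuclideanSpace ℝ (Fin d)) :
    fourierHat (packet β A ξ₀ v a) ξ = packetHat β A ξ₀ v a ξ := by
  rw [fourierHat, ← SchwartzMap.fourier_coe, packet, FourierTransform.fourier_fourierInv_eq]
  change packetHat β A ξ₀ v a ((2 * Real.pi) • (2 * Real.pi)⁻¹ • ξ) = _
  rw [smul_smul, mul_inv_cancel₀ (by positivity), one_smul]

theorem packet_apply (x : EuclideanSpace ℝ (Fin d)) :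
    packet β A ξ₀ v a x =
      ∫ ζ, Complex.exp (((2 * Real.pi * inner ℝ ζ x : ℝ) : ℂ) * Complex.I) *
        packetHat β A ξ₀ v a ((2 * Real.pi) • ζ) := by
  rw [packet, SchwartzMap.fourierInv_coe, Real.fourierInv_eq']
  rfl

variable {A} in
/-- On the physical side, a packet is a modulation of the mother packet, rescaled by `A` and
translated by `v`. -/
theorem norm_packet (hA : ∀ x y, inner ℝ (A x) y = inner ℝ x (A y))
    (x : EuclideanSpace ℝ (Fin d)) :
    ‖packet β A ξ₀ v a x‖ =
      |LinearMap.det (A : EuclideanSpace ℝ (Fin d) →ₗ[ℝ] EuclideanSpace ℝ (Fin d))| *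
        ‖packet β (ContinuousLinearEquiv.refl ℝ _) 0 0 0 (A (x - v))‖ := by
  rw [packet_apply, packet_apply,
    integral_eq_abs_det_mul_integral_affine A ((2 * Real.pi)⁻¹ • ξ₀), norm_smul,
    Real.norm_eq_abs, abs_abs]
  congr 1
  have key : ∀ ζ : EuclideanSpace ℝ (Fin d),
      Complex.exp (((2 * Real.pi * inner ℝ (A ζ + (2 * Real.pi)⁻¹ • ξ₀) x : ℝ) : ℂ) * Complex.I) *
        packetHat β A ξ₀ v a ((2 * Real.pi) • (A ζ + (2 * Real.pi)⁻¹ • ξ₀)) =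
      Complex.exp (((inner ℝ ξ₀ (x - v) - a : ℝ) : ℂ) * Complex.I) *
      (Complex.exp (((2 * Real.pi * inner ℝ ζ (A (x - v)) : ℝ) : ℂ) * Complex.I) *
        packetHat β (ContinuousLinearEquiv.refl ℝ _) 0 0 0 ((2 * Real.pi) • ζ)) := by
    intro ζ
    have hpi : (2 * Real.pi) ≠ 0 := by positivity
    have h1 : A.symm ((2 * Real.pi) • (A ζ + (2 * Real.pi)⁻¹ • ξ₀) - ξ₀) = (2 * Real.pi) • ζ := by
      rw [smul_add, smul_smul, mul_inv_cancel₀ hpi, one_smul, add_sub_cancel_right, map_smul,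
        A.symm_apply_apply]
    have h2 : ((2 * Real.pi) • ζ : EuclideanSpace ℝ (Fin d)) - 0 = (2 * Real.pi) • ζ := sub_zero _
    simp only [packetHat, h1, h2, ContinuousLinearEquiv.refl_symm, ContinuousLinearEquiv.coe_refl',
      id_eq, ← mul_assoc]
    congr 1
    rw [← Complex.exp_add, ← Complex.exp_add, ← Complex.exp_add]
    congr 1
    rw [← hA ζ, inner_add_left, real_inner_smul_left, real_inner_smul_right, inner_add_right,
      real_inner_smul_right, inner_sub_right, inner_sub_right, real_inner_comm (A ζ) v,
      real_inner_comm ξ₀ v]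
    simp only [inner_zero_left]
    push_cast
    field_simp
    ring
  simp_rw [key]
  rw [integral_const_mul, norm_mul, Complex.norm_exp_ofReal_mul_I, one_mul]

end Packet

/-! ### Lattice sums -/

theorem summable_inv_one_add_mul_int_sq {ε : ℝ} (hε : 0 < ε) :
    Summable fun j : ℤ => (1 + (ε * j) ^ 2)⁻¹ := by
  have h1 : Summable fun j : ℤ => (ε ^ 2)⁻¹ * (1 / (j : ℝ) ^ 2) :=
    (Real.summable_one_div_int_pow.2 one_lt_two).mul_left _
  have h2 : Summable fun j : ℤ => if j = 0 then (1 : ℝ) else 0 :=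
    (hasSum_ite_eq (0 : ℤ) (1 : ℝ)).summable
  refine Summable.of_nonneg_of_le (fun j => by positivity) (fun j => ?_) (h1.add h2)
  rcases eq_or_ne j 0 with rfl | hj
  · simp
  · have hj' : (j : ℝ) ≠ 0 := Int.cast_ne_zero.2 hj
    rw [if_neg hj, add_zero, one_div, ← mul_inv, ← mul_pow]
    exact inv_anti₀ (by positivity) (by linarith)

theorem exists_sum_inv_one_add_sq_le {ε : ℝ} (hε : 0 < ε) :
    ∃ C : ℝ, ∀ (K : ℕ) (b : ℝ), ∑ j : Fin K, (1 + (b - ε * (j : ℕ)) ^ 2)⁻¹ ≤ C := by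
  set u : ℤ → ℝ := fun j => (1 + (ε * j) ^ 2)⁻¹ with hu
  have hsum : Summable u := summable_inv_one_add_mul_int_sq hε
  have hu0 : ∀ j, 0 ≤ u j := fun j => by simp only [hu]; positivity
  have hshift : ∀ (K : ℕ) (n : ℤ), ∑ j : Fin K, u (n - (j : ℕ)) ≤ ∑' j, u j := by
    intro K n
    have hinj : Function.Injective fun j : Fin K => n - ((j : ℕ) : ℤ) := by
      intro i j h
      simp only [sub_right_inj, Nat.cast_inj] at h
      exact Fin.ext h
    have := hsum.sum_le_tsum (Finset.univ.map ⟨_, hinj⟩) (fun j _ => hu0 j)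
    simpa [Finset.sum_map] using this
  refine ⟨(∑' j, u j) + ∑' j, u j, fun K b => ?_⟩
  -- compare `b / ε` with its two integer neighbours: one of them is nearer to each lattice point
  set n : ℤ := ⌊b / ε⌋ with hn
  have hb : b = ε * (b / ε) := by field_simp
  have h1 : (n : ℝ) ≤ b / ε := Int.floor_le _
  have h2 : b / ε < n + 1 := Int.lt_floor_add_one _
  calc ∑ j : Fin K, (1 + (b - ε * (j : ℕ)) ^ 2)⁻¹
      ≤ ∑ j : Fin K, (u (n - (j : ℕ)) + u (n + 1 - (j : ℕ))) := by
        refine Finset.sum_le_sum fun j _ => ?_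
        have hbj : b - ε * (j : ℕ) = ε * (b / ε - (j : ℕ)) := by rw [mul_sub, ← hb]
        rw [hbj]
        rcases le_or_gt ((j : ℕ) : ℤ) n with hj | hj
        · have hj' : ((j : ℕ) : ℝ) ≤ n := by exact_mod_cast hj
          refine le_trans (inv_anti₀ (by positivity) ?_) (le_add_of_nonneg_right (hu0 _))
          push_cast
          have : ε * (n - (j : ℕ)) ≤ ε * (b / ε - (j : ℕ)) := by gcongr
          have h0 : 0 ≤ ε * (n - (j : ℕ) : ℝ) := mul_nonneg hε.le (by linarith)
          gcongr
        · have hj' : (n : ℝ) + 1 ≤ ((j : ℕ) : ℝ) := by exact_mod_cast hj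
          refine le_trans (inv_anti₀ (by positivity) ?_) (le_add_of_nonneg_left (hu0 _))
          push_cast
          rw [← neg_sq, ← neg_sq (ε * (b / ε - (j : ℕ))), ← mul_neg, ← mul_neg, neg_sub, neg_sub]
          have h0 : 0 ≤ ε * ((j : ℕ) - (n + 1) : ℝ) := mul_nonneg hε.le (by linarith)
          gcongr
    _ ≤ _ := by
        rw [Finset.sum_add_distrib]
        exact add_le_add (hshift K n) (hshift K (n + 1))

theorem exists_norm_le_inv_one_add_sq_pow {d : ℕ} (g : 𝓢(EuclideanSpace ℝ (Fin d), ℂ)) (n : ℕ) :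
    ∃ C : ℝ, 0 ≤ C ∧ ∀ y, ‖g y‖ ≤ C * ((1 + ‖y‖ ^ 2) ^ n)⁻¹ := by
  refine ⟨2 ^ (2 * n) * ((Finset.Iic ((2 * n, 0) : ℕ × ℕ)).sup
      fun m => SchwartzMap.seminorm ℝ m.1 m.2) g, by positivity, fun y => ?_⟩
  have h := SchwartzMap.one_add_le_sup_seminorm_apply (𝕜 := ℝ) (m := (2 * n, 0)) (k := 2 * n)
    (n := 0) le_rfl le_rfl g y
  rw [norm_iteratedFDeriv_zero] at h
  rw [← div_eq_mul_inv, le_div_iff₀ (by positivity)]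
  refine le_trans ?_ h
  rw [mul_comm, pow_mul]
  have : 1 + ‖y‖ ^ 2 ≤ (1 + ‖y‖) ^ 2 := by nlinarith [norm_nonneg y]
  gcongr

/-- Packets of width at most `1 / R`, whose centres form a lattice of spacing `ε / R` in the
coordinates selected by `e`, overlap boundedly often, whatever their number and their shapes. -/
theorem exists_sum_norm_le {d : ℕ} {ι : Type} [Fintype ι] [DecidableEq ι]
    (g : 𝓢(EuclideanSpace ℝ (Fin d), ℂ)) (e : ι → Fin d) (o : ι → ℝ) {ε : ℝ} (hε : 0 < ε) :
    ∃ C : ℝ, 0 ≤ C ∧ ∀ (K : ℕ) (R : ℝ), 0 < R → ∀ (v : (ι → Fin K) → EuclideanSpace ℝ (Fin d))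
      (A : (ι → Fin K) → EuclideanSpace ℝ (Fin d) ≃L[ℝ] EuclideanSpace ℝ (Fin d)),
      (∀ j y, R * ‖y‖ ≤ ‖A j y‖) → (∀ j i, v j (e i) = o i + ε * (j i : ℕ) / R) →
      ∀ x, ∑ j, ‖g (A j (x - v j))‖ ≤ C := by
  obtain ⟨C₀, hC₀, hg⟩ := exists_norm_le_inv_one_add_sq_pow g (Fintype.card ι)
  obtain ⟨C₁, hC₁⟩ := exists_sum_inv_one_add_sq_le hε
  have hC₁0 : 0 ≤ C₁ := by simpa using hC₁ 0 0
  refine ⟨C₀ * C₁ ^ Fintype.card ι, by positivity, fun K R hR v A hA hv x => ?_⟩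
  calc ∑ j, ‖g (A j (x - v j))‖
      ≤ ∑ j : ι → Fin K, C₀ * ∏ i, (1 + (R * (x (e i) - o i) - ε * (j i : ℕ)) ^ 2)⁻¹ := by
        refine Finset.sum_le_sum fun j _ => (hg _).trans ?_
        rw [Finset.prod_inv_distrib]
        refine mul_le_mul_of_nonneg_left (inv_anti₀
          (Finset.prod_pos fun i _ => by positivity) ?_) hC₀
        rw [← Finset.card_univ, ← Finset.prod_const]
        refine Finset.prod_le_prod (fun i _ => by positivity) fun i _ => ?_
        have h1 : R * (x (e i) - o i) - ε * (j i : ℕ) = R * (x - v j) (e i) := by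
          rw [PiLp.sub_apply, hv]
          field_simp
          ring
        have h2 : |R * (x - v j) (e i)| ≤ ‖A j (x - v j)‖ := by
          rw [abs_mul, abs_of_pos hR]
          refine le_trans ?_ (hA j _)
          gcongr
          exact PiLp.norm_apply_le (x - v j) (e i)
        rw [h1, ← sq_abs]
        gcongr
    _ = C₀ * ∏ i, ∑ j : Fin K, (1 + (R * (x (e i) - o i) - ε * (j : ℕ)) ^ 2)⁻¹ := by
        rw [← Finset.mul_sum, Finset.prod_univ_sum, Fintype.piFinset_univ]
    _ ≤ C₀ * C₁ ^ Fintype.card ι := by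
        rw [← Finset.card_univ, ← Finset.prod_const]
        gcongr
        exact hC₁ _ _

/-! ### The two sides of the estimate for a superposition of packets -/

/-- The interpolation inequality `‖f‖_p ≤ ‖f‖_∞ ^ (1 - 1/p) * ‖f‖_1 ^ (1/p)`. -/
theorem eLpNorm_le_of_bound_of_lintegral {α : Type*} [MeasurableSpace α] {μ : Measure α}
    {f : α → ℂ} {p B T : ℝ} (hp : 1 ≤ p) (hB : 0 ≤ B) (hfB : ∀ x, ‖f x‖ ≤ B) (hT : 0 ≤ T)
    (hfT : ∫⁻ x, ‖f x‖ₑ ∂μ ≤ ENNReal.ofReal T) :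
    eLpNorm f (ENNReal.ofReal p) μ ≤ ENNReal.ofReal (B ^ (1 - 1 / p) * T ^ (1 / p)) := by
  have hp0 : 0 < p := by linarith
  rw [eLpNorm_eq_lintegral_rpow_enorm_toReal (by simpa using hp0) ENNReal.ofReal_ne_top,
    ENNReal.toReal_ofReal hp0.le]
  have h1 : ∫⁻ x, ‖f x‖ₑ ^ p ∂μ ≤ ENNReal.ofReal B ^ (p - 1) * ENNReal.ofReal T := by
    calc ∫⁻ x, ‖f x‖ₑ ^ p ∂μ ≤ ∫⁻ x, ENNReal.ofReal B ^ (p - 1) * ‖f x‖ₑ ∂μ := by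
          refine lintegral_mono fun x => ?_
          have hx : ‖f x‖ₑ ≤ ENNReal.ofReal B := by
            rw [← ofReal_norm]
            exact ENNReal.ofReal_le_ofReal (hfB x)
          calc ‖f x‖ₑ ^ p = ‖f x‖ₑ ^ ((p - 1) + 1) := by ring_nf
            _ = ‖f x‖ₑ ^ (p - 1) * ‖f x‖ₑ := by
              rw [ENNReal.rpow_add_of_nonneg _ _ (by linarith) zero_le_one, ENNReal.rpow_one]
            _ ≤ _ := by
              gcongr
      _ = ENNReal.ofReal B ^ (p - 1) * ∫⁻ x, ‖f x‖ₑ ∂μ := by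
          rw [lintegral_const_mul']
          exact ENNReal.rpow_ne_top_of_nonneg (by linarith) ENNReal.ofReal_ne_top
      _ ≤ _ := by gcongr
  refine (ENNReal.rpow_le_rpow h1 (by positivity)).trans (le_of_eq ?_)
  rw [ENNReal.mul_rpow_of_nonneg _ _ (by positivity), ← ENNReal.rpow_mul,
    ENNReal.ofReal_mul (by positivity), ENNReal.ofReal_rpow_of_nonneg hB (by
      rw [mul_one_div]; exact div_nonneg (by linarith) hp0.le),
    ENNReal.ofReal_rpow_of_nonneg hT (by positivity)]
  congr 3
  field_simp

theorem le_eLpNorm_of_le_norm {α : Type*} [MeasurableSpace α] {μ : Measure α} {F : α → ℂ}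
    {p c V : ℝ} (hp : 1 ≤ p) (hc : 0 ≤ c) (hV : 0 ≤ V) {Q : Set α} (hQ : MeasurableSet Q)
    (hQV : μ Q = ENNReal.ofReal V) (hF : ∀ z ∈ Q, c ≤ ‖F z‖) :
    ENNReal.ofReal (c * V ^ (1 / p)) ≤ eLpNorm F (ENNReal.ofReal p) μ := by
  have hp0 : 0 < p := by linarith
  calc ENNReal.ofReal (c * V ^ (1 / p))
      = eLpNorm (Q.indicator fun _ => c) (ENNReal.ofReal p) μ := by
        rw [eLpNorm_indicator_const hQ (by simpa using hp0) ENNReal.ofReal_ne_top, hQV,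
          ENNReal.toReal_ofReal hp0.le, ENNReal.ofReal_mul hc,
          ENNReal.ofReal_rpow_of_nonneg hV (by positivity), Real.enorm_of_nonneg hc]
    _ ≤ _ := by
        refine eLpNorm_mono fun z => ?_
        by_cases hz : z ∈ Q
        · rw [Set.indicator_of_mem hz, Real.norm_of_nonneg hc]
          exact hF z hz
        · rw [Set.indicator_of_notMem hz, norm_zero]
          exact norm_nonneg _

section Superposition

variable {d : ℕ} {J : Type} [Fintype J] {χ₀ : EuclideanSpace ℝ (Fin d) → ℝ}
  (β : ContDiffBump (0 : EuclideanSpace ℝ (Fin d)))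
  (A : J → EuclideanSpace ℝ (Fin d) ≃L[ℝ] EuclideanSpace ℝ (Fin d))
  (ξ₀ v : J → EuclideanSpace ℝ (Fin d)) (a : J → ℝ)

theorem fourierHat_sum_packet (ξ : EuclideanSpace ℝ (Fin d)) :
    fourierHat (∑ j, packet β (A j) (ξ₀ j) (v j) (a j)) ξ =
      ∑ j, packetHat β (A j) (ξ₀ j) (v j) (a j) ξ := by
  have h : ∀ f : 𝓢(EuclideanSpace ℝ (Fin d), ℂ),
      fourierHat f ξ = (𝓕 f : 𝓢(EuclideanSpace ℝ (Fin d), ℂ)) ((2 * Real.pi)⁻¹ • ξ) :=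
    fun f => by rw [fourierHat, SchwartzMap.fourier_coe]
  simp_rw [← fourierHat_packet]
  rw [h, ← SchwartzMap.fourierTransformCLM_apply (𝕜 := ℂ), map_sum, sum_apply]
  simp_rw [h]
  rfl

variable {A ξ₀ v a} in
/-- At a point where all packets are in phase, there is no cancellation in the propagator. -/
theorem le_norm_propagator_sum_packet {m N t α : ℝ} {x : EuclideanSpace ℝ (Fin d)}
    (hcut : ∀ j ξ, ‖(A j).symm (ξ - ξ₀ j)‖ < β.rOut → dyadicCutoff χ₀ N ξ = 1)
    (hphase : ∀ j ξ, ‖(A j).symm (ξ - ξ₀ j)‖ < β.rOut →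
      |inner ℝ x ξ + t * √(‖ξ‖ ^ 2 + m ^ 2) - (a j + inner ℝ (v j) ξ) - α| ≤ 1) :
    Real.cos 1 * ∑ j, |LinearMap.det
      (A j : EuclideanSpace ℝ (Fin d) →ₗ[ℝ] EuclideanSpace ℝ (Fin d))| * ∫ ξ, β ξ ≤
      ‖propagator χ₀ m N (∑ j, packet β (A j) (ξ₀ j) (v j) (a j)) x t‖ := by
  set ψ : J → EuclideanSpace ℝ (Fin d) → ℝ := fun j ξ =>
    inner ℝ x ξ + t * √(‖ξ‖ ^ 2 + m ^ 2) - (a j + inner ℝ (v j) ξ) - α with hψ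
  set b : J → EuclideanSpace ℝ (Fin d) → ℝ := fun j ξ => β ((A j).symm (ξ - ξ₀ j)) with hb
  have hbc : ∀ j, Continuous (b j) := fun j => β.continuous.comp (by fun_prop)
  have hψc : ∀ j, Continuous (ψ j) := fun j => by
    simp only [hψ]
    fun_prop
  have hbs : ∀ j, HasCompactSupport (b j) := fun j => hasCompactSupport_bump_affine β (A j) (ξ₀ j)
  have hb0 : ∀ j ξ, b j ξ ≠ 0 → ‖(A j).symm (ξ - ξ₀ j)‖ < β.rOut := by
    intro j ξ h
    by_contra hlt
    exact h (β.zero_of_le_dist (by simpa using hlt))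
  have hprop : propagator χ₀ m N (∑ j, packet β (A j) (ξ₀ j) (v j) (a j)) x t =
      Complex.exp (Complex.I * (α : ℂ)) *
        ∫ ξ, ∑ j, Complex.exp (Complex.I * (ψ j ξ : ℂ)) * (b j ξ : ℂ) := by
    rw [propagator, ← integral_const_mul]
    congr 1
    funext ξ
    rw [fourierHat_sum_packet, Finset.mul_sum, Finset.mul_sum]
    refine Finset.sum_congr rfl fun j _ => ?_
    rw [packetHat]
    change _ * (_ * (b j ξ : ℂ)) = _
    rcases eq_or_ne (b j ξ) 0 with h | h
    · rw [h]; simp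
    · rw [hcut j ξ (hb0 j ξ h), Complex.ofReal_one, mul_one, ← mul_assoc, ← mul_assoc,
        ← Complex.exp_add, ← Complex.exp_add]
      congr 2
      simp only [hψ]
      push_cast
      ring
  have hint : ∀ j, Integrable fun ξ => Complex.exp (Complex.I * (ψ j ξ : ℂ)) * (b j ξ : ℂ) := by
    intro j
    refine Continuous.integrable_of_hasCompactSupport ?_ ?_
    · have := hbc j
      have := hψc j
      fun_prop
    · refine (hbs j).mono fun ξ hξ => ?_
      rw [Function.mem_support] at hξ ⊢
      intro h
      exact hξ (by rw [h]; simp)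
  have hbint : ∀ j, Integrable (b j) := fun j => (hbc j).integrable_of_hasCompactSupport (hbs j)
  rw [hprop, norm_mul, mul_comm Complex.I, Complex.norm_exp_ofReal_mul_I, one_mul]
  refine le_trans ?_ (Complex.re_le_norm _)
  rw [integral_finsetSum _ fun j _ => hint j, Complex.re_sum, Finset.mul_sum]
  refine Finset.sum_le_sum fun j _ => ?_
  rw [← integral_bump_affine β (A j) (ξ₀ j), ← integral_const_mul]
  have hre := Complex.reCLM.integral_comp_comm (hint j)
  simp only [Complex.reCLM_apply] at hre
  rw [← hre]
  refine integral_mono ((hbint j).const_mul _) (hint j).re fun ξ => ?_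
  change Real.cos 1 * b j ξ ≤ (Complex.exp (Complex.I * (ψ j ξ : ℂ)) * (b j ξ : ℂ)).re
  rw [Complex.re_mul_ofReal, mul_comm Complex.I, Complex.exp_ofReal_mul_I_re]
  rcases eq_or_ne (b j ξ) 0 with h | h
  · rw [h]; simp
  · refine mul_le_mul_of_nonneg_right ?_ β.nonneg
    rw [← Real.cos_abs (ψ j ξ)]
    exact Real.cos_le_cos_of_nonneg_of_le_pi (abs_nonneg _) (by linarith [Real.pi_gt_three])
      (hphase j ξ (hb0 j ξ h))

end Superposition

/-- The estimate `LocalSmoothing` tested on a superposition of packets: `K ^ card ι` packets of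
volume about `1 / Δ`, which overlap boundedly often at time `0` and are all in phase on `Q`, a set
of volume `V`. The `L^p` norm of the data is `O(Δ ^ (1 - 1/p) (K ^ card ι) ^ (1/p))`. -/
theorem LocalSmoothing.exists_packet_bound {d : ℕ} {χ₀ : EuclideanSpace ℝ (Fin d) → ℝ} {p s : ℝ}
    {M : Set ℝ} (h : LocalSmoothing χ₀ p s M) (hp : 1 ≤ p)
    (β : ContDiffBump (0 : EuclideanSpace ℝ (Fin d))) {ι : Type} [Fintype ι] [DecidableEq ι]
    (e : ι → Fin d) (o : ι → ℝ) {ε : ℝ} (hε : 0 < ε) :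
    ∃ C : ℝ, ∀ (k : ℕ), ∀ m ∈ M, ∀ (K : ℕ) (R Δ V : ℝ), 0 < R → 0 < Δ → 0 ≤ V →
      ∀ (A : (ι → Fin K) → EuclideanSpace ℝ (Fin d) ≃L[ℝ] EuclideanSpace ℝ (Fin d))
        (ξ₀ v : (ι → Fin K) → EuclideanSpace ℝ (Fin d)) (a : (ι → Fin K) → ℝ)
        (Q : Set (ℝ × EuclideanSpace ℝ (Fin d))),
      (∀ j x y, inner ℝ (A j x) y = inner ℝ x (A j y)) →
      (∀ j, LinearMap.det
        (A j : EuclideanSpace ℝ (Fin d) →ₗ[ℝ] EuclideanSpace ℝ (Fin d)) = Δ) →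
      (∀ j y, R * ‖y‖ ≤ ‖A j y‖) →
      (∀ j i, v j (e i) = o i + ε * (j i : ℕ) / R) →
      MeasurableSet Q → Q ⊆ Set.Icc 0 1 ×ˢ Set.univ → volume Q = ENNReal.ofReal V →
      (∀ j ξ, ‖(A j).symm (ξ - ξ₀ j)‖ < β.rOut → dyadicCutoff χ₀ (2 ^ k) ξ = 1) →
      (∀ z ∈ Q, ∃ α : ℝ, ∀ j ξ, ‖(A j).symm (ξ - ξ₀ j)‖ < β.rOut →
        |inner ℝ z.2 ξ + z.1 * √(‖ξ‖ ^ 2 + m ^ 2) - (a j + inner ℝ (v j) ξ) - α| ≤ 1) →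
      (K : ℝ) ^ Fintype.card ι * (Δ * V) ^ (1 / p) ≤
        C * ((2 : ℝ) ^ k) ^ s * ((K : ℝ) ^ Fintype.card ι) ^ (1 / p) := by
  obtain ⟨C, hC⟩ := h
  set g := packet β (ContinuousLinearEquiv.refl ℝ _) 0 0 0 with hg
  obtain ⟨C₁, hC₁, hsum⟩ := exists_sum_norm_le g e o hε
  have hb : 0 < ∫ ξ, β ξ := β.integral_pos
  have hcos : 0 < Real.cos 1 := Real.cos_one_pos
  set L : ℝ := ∫ x, ‖g x‖ with hL
  have hL0 : 0 ≤ L := integral_nonneg fun x => norm_nonneg _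
  have hLl : ∫⁻ x, ‖g x‖ₑ = ENNReal.ofReal L := by
    rw [hL, ofReal_integral_norm_eq_lintegral_enorm g.integrable]
  refine ⟨C * (C₁ ^ (1 - 1 / p) * L ^ (1 / p)) / (Real.cos 1 * ∫ ξ, β ξ), ?_⟩
  intro k m hm K R Δ V hR hΔ hV A ξ₀ v a Q hsymm hdet hAR hv hQ hQI hQV hcut hphase
  set n : ℝ := (K : ℝ) ^ Fintype.card ι with hn
  have hn0 : 0 ≤ n := by positivity
  have hcard : ((Finset.univ : Finset (ι → Fin K)).card : ℝ) = n := by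
    simp [hn]
  set f := ∑ j, packet β (A j) (ξ₀ j) (v j) (a j) with hf
  have hfx : ∀ x, f x = ∑ j, packet β (A j) (ξ₀ j) (v j) (a j) x := fun x => by
    rw [hf, sum_apply]
  have hpk : ∀ j x, ‖packet β (A j) (ξ₀ j) (v j) (a j) x‖ = Δ * ‖g (A j (x - v j))‖ :=
    fun j x => by rw [norm_packet β (ξ₀ j) (v j) (a j) (hsymm j), hdet, abs_of_pos hΔ]
  have hsup : ∀ x, ‖f x‖ ≤ Δ * C₁ := by
    intro x
    rw [hfx]
    refine (norm_sum_le _ _).trans ?_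
    simp_rw [hpk]
    rw [← Finset.mul_sum]
    exact mul_le_mul_of_nonneg_left (hsum K R hR v A hAR hv x) hΔ.le
  have hone : ∫⁻ x, ‖f x‖ₑ ≤ ENNReal.ofReal (n * L) := by
    calc ∫⁻ x, ‖f x‖ₑ ≤ ∫⁻ x, ∑ j, ‖packet β (A j) (ξ₀ j) (v j) (a j) x‖ₑ := by
          refine lintegral_mono fun x => ?_
          rw [hfx]
          exact enorm_sum_le _ _
      _ = ∑ j, ∫⁻ x, ‖packet β (A j) (ξ₀ j) (v j) (a j) x‖ₑ :=
          lintegral_finsetSum _ fun j _ =>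
            (packet β (A j) (ξ₀ j) (v j) (a j)).continuous.measurable.enorm
      _ = ∑ j : ι → Fin K, ENNReal.ofReal L := by
          refine Finset.sum_congr rfl fun j _ => ?_
          have hcv := lintegral_eq_abs_det_mul_lintegral_affine (A j) (-(A j (v j))) fun x => ‖g x‖ₑ
          rw [← hLl, hcv, hdet, abs_of_pos hΔ, ← lintegral_const_mul' _ _ ENNReal.ofReal_ne_top]
          refine lintegral_congr fun x => ?_
          rw [← ofReal_norm, hpk, ENNReal.ofReal_mul hΔ.le, ofReal_norm, map_sub, sub_eq_add_neg]
      _ = ENNReal.ofReal (n * L) := by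
          rw [Finset.sum_const, nsmul_eq_mul, ENNReal.ofReal_mul hn0, ← hcard,
            ENNReal.ofReal_natCast]
  have hupper := eLpNorm_le_of_bound_of_lintegral (μ := volume) hp (by positivity) hsup
    (by positivity) hone
  have hlower := le_eLpNorm_of_le_norm
    (μ := volume.restrict (Set.Icc (0 : ℝ) 1 ×ˢ (Set.univ : Set (EuclideanSpace ℝ (Fin d)))))
    (F := fun z => propagator χ₀ m (2 ^ k) f z.2 z.1) (p := p) (V := V)
    (c := Real.cos 1 * (n * (Δ * ∫ ξ, β ξ))) hp (by positivity) hV hQ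
    (by rw [Measure.restrict_apply hQ, Set.inter_eq_left.2 hQI, hQV])
    (fun z hz => by
      obtain ⟨α, hα⟩ := hphase z hz
      have := le_norm_propagator_sum_packet β (m := m) (N := 2 ^ k) hcut hα
      simp_rw [hdet, abs_of_pos hΔ] at this
      rwa [Finset.sum_const, nsmul_eq_mul, hcard] at this)
  have hmain := (hlower.trans (hC k m hm f)).trans (mul_le_mul_right hupper _)
  rw [← ENNReal.ofReal_coe_nnreal, ← ENNReal.ofReal_mul C.coe_nonneg,
    ← ENNReal.ofReal_mul (by positivity), ENNReal.ofReal_le_ofReal_iff (by positivity)] at hmain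
  have hΔp : Δ = Δ ^ (1 - 1 / p) * Δ ^ (1 / p) := by
    rw [← Real.rpow_add hΔ, sub_add_cancel, Real.rpow_one]
  rw [Real.mul_rpow hΔ.le hC₁, Real.mul_rpow hn0 hL0] at hmain
  have hΔq : 0 < Δ ^ (1 - 1 / p) := Real.rpow_pos_of_pos hΔ _
  rw [Real.mul_rpow hΔ.le hV, div_mul_eq_mul_div, div_mul_eq_mul_div, le_div_iff₀ (by positivity)]
  refine le_of_mul_le_mul_left ?_ hΔq
  calc Δ ^ (1 - 1 / p) * (n * (Δ ^ (1 / p) * V ^ (1 / p)) * (Real.cos 1 * ∫ ξ, β ξ))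
      = Real.cos 1 * (n * ((Δ ^ (1 - 1 / p) * Δ ^ (1 / p)) * ∫ ξ, β ξ)) * V ^ (1 / p) := by ring
    _ ≤ C * (2 ^ k) ^ s *
        (Δ ^ (1 - 1 / p) * C₁ ^ (1 - 1 / p) * (n ^ (1 / p) * L ^ (1 / p))) := by
        rw [← hΔp]
        exact hmain
    _ = _ := by ring

/-! ### The cutoff, the phase and the region of focusing -/

/-- The cutoff `χ_N` is identically one on a thin annulus inside `N ≤ ‖ξ‖ ≤ 2 N`, because the
support of `χ₀` stays away from the sphere of radius `2`. -/
theorem IsRadialCutoff.exists_dyadicCutoff_eq_one {d : ℕ} {χ₀ : EuclideanSpace ℝ (Fin d) → ℝ}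
    (hχ₀ : IsRadialCutoff χ₀) :
    ∃ c δ : ℝ, 0 < δ ∧ 1 ≤ c - δ ∧ c + δ ≤ 2 ∧ ∀ (N : ℝ) (ξ : EuclideanSpace ℝ (Fin d)), 0 < N →
      |‖ξ‖ - c * N| ≤ δ * N → dyadicCutoff χ₀ N ξ = 1 := by
  obtain ⟨r, hr2, hr⟩ := exists_lt_subset_ball (isClosed_tsupport χ₀) hχ₀.tsupport_subset
  set r' := max r 1 with hr'
  have hr'2 : r' < 2 := max_lt hr2 one_lt_two
  have hr'1 : 1 ≤ r' := le_max_right _ _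
  refine ⟨(r' + 2) / 2, (2 - r') / 2, by linarith, by linarith, by linarith, ?_⟩
  intro N ξ hN hξ
  rw [abs_le] at hξ
  have hn : ‖N⁻¹ • ξ‖ = ‖ξ‖ / N := by
    rw [norm_smul, norm_inv, Real.norm_of_nonneg hN.le, inv_mul_eq_div]
  have h1 : r' ≤ ‖N⁻¹ • ξ‖ := by
    rw [hn, le_div_iff₀ hN]
    linarith [hξ.1]
  have h2 : ‖N⁻¹ • ξ‖ ≤ 2 := by
    rw [hn, div_le_iff₀ hN]
    linarith [hξ.2]
  rw [dyadicCutoff, annulusCutoff, hχ₀.eq_one _ (by rw [norm_smul]; norm_num; linarith),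
    image_eq_zero_of_notMem_tsupport (f := χ₀) (x := N⁻¹ • ξ), sub_zero]
  intro hmem
  have h3 := mem_ball_zero_iff.1 (hr hmem)
  exact absurd (h3.trans_le ((le_max_left r 1).trans h1)) (lt_irrefl _)

theorem abs_sub_le_of_abs_sq_sub_sq_le {φ γ X κ : ℝ} (hX : 0 < X) (hφ : X ≤ φ) (hγ : 0 ≤ γ)
    (h : |φ ^ 2 - γ ^ 2| ≤ κ * X) : |φ - γ| ≤ κ := by
  refine le_of_mul_le_mul_right (le_trans ?_ h) hX
  rw [sq_sub_sq, abs_mul, mul_comm |φ + γ|]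
  refine mul_le_mul_of_nonneg_left ?_ (abs_nonneg _)
  exact le_trans (by linarith) (le_abs_self _)

theorem abs_sqrt_norm_sq_add_sub_le {d : ℕ} (m : ℝ) (ξ η : EuclideanSpace ℝ (Fin d))
    (hη : 0 < ‖η‖) : |√(‖ξ‖ ^ 2 + m ^ 2) - √(‖η‖ ^ 2 + m ^ 2)| ≤ ‖ξ - η‖ := by
  set φ := √(‖ξ‖ ^ 2 + m ^ 2) with hφ
  set γ := √(‖η‖ ^ 2 + m ^ 2) with hγ
  have hφ2 : φ ^ 2 = ‖ξ‖ ^ 2 + m ^ 2 := Real.sq_sqrt (by positivity)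
  have hγ2 : γ ^ 2 = ‖η‖ ^ 2 + m ^ 2 := Real.sq_sqrt (by positivity)
  have hφξ : ‖ξ‖ ≤ φ := Real.le_sqrt_of_sq_le (by nlinarith)
  have hγη : ‖η‖ ≤ γ := Real.le_sqrt_of_sq_le (by nlinarith)
  have hpos : 0 < φ + γ := by linarith [norm_nonneg ξ]
  refine le_of_mul_le_mul_right ?_ hpos
  have h1 : |φ - γ| * (φ + γ) = |‖ξ‖ - ‖η‖| * (‖ξ‖ + ‖η‖) := by
    rw [← abs_of_pos hpos, ← abs_mul,
      ← abs_of_nonneg (add_nonneg (norm_nonneg ξ) (norm_nonneg η)), ← abs_mul]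
    congr 1
    linear_combination hφ2 - hγ2
  rw [h1]
  exact mul_le_mul (abs_norm_sub_norm_le ξ η) (by linarith) (by positivity) (norm_nonneg _)

/-- The space-time region of side about `1 / N` around the focal point `(t, x) = (1, 0)`. -/
def focalRegion (d : ℕ) (N : ℝ) : Set (ℝ × EuclideanSpace ℝ (Fin d)) :=
  Set.Icc (1 - 1 / (20 * N)) 1 ×ˢ Metric.ball 0 (1 / (16 * N))

theorem measurableSet_focalRegion (d : ℕ) (N : ℝ) : MeasurableSet (focalRegion d N) :=
  measurableSet_Icc.prod measurableSet_ball

theorem focalRegion_subset {d : ℕ} {N : ℝ} (hN : 1 ≤ N) :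
    focalRegion d N ⊆ Set.Icc 0 1 ×ˢ Set.univ := by
  refine Set.prod_mono (Set.Icc_subset_Icc_left ?_) (Set.subset_univ _)
  rw [sub_nonneg, div_le_one (by positivity)]
  linarith

theorem exists_volume_focalRegion (d : ℕ) :
    ∃ κ : ℝ, 0 < κ ∧ ∀ N : ℝ, 1 ≤ N →
      volume (focalRegion d N) = ENNReal.ofReal (κ * (N ^ (d + 1))⁻¹) := by
  have hb : 0 < (volume (Metric.ball (0 : EuclideanSpace ℝ (Fin d)) 1)).toReal :=
    ENNReal.toReal_pos (Metric.measure_ball_pos _ _ one_pos).ne' measure_ball_lt_top.ne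
  refine ⟨1 / 20 * (1 / 16) ^ d * (volume (Metric.ball (0 : EuclideanSpace ℝ (Fin d)) 1)).toReal,
    by positivity, fun N hN => ?_⟩
  have hN0 : 0 < N := by linarith
  rw [focalRegion, Measure.volume_eq_prod, Measure.prod_prod, Real.volume_Icc,
    Measure.addHaar_ball_of_pos _ _ (by positivity), finrank_euclideanSpace_fin,
    ← ENNReal.ofReal_toReal (measure_ball_lt_top (μ := volume)
      (x := (0 : EuclideanSpace ℝ (Fin d))) (r := 1)).ne,
    ← ENNReal.ofReal_mul (by positivity), ← ENNReal.ofReal_mul (by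
      rw [sub_sub_cancel]; positivity), ENNReal.toReal_ofReal ENNReal.toReal_nonneg]
  congr 1
  rw [sub_sub_cancel, div_pow, div_pow, mul_pow]
  field_simp
  ring

/-- On the focal region, a frequency at which the phase of the propagator at time `1` is within
`1 / 2` of the phase `γ` prescribed for the data contributes almost in phase. -/
theorem abs_phase_le_of_mem_focalRegion {d : ℕ} {N m γ : ℝ} (hN : 1 ≤ N) (hm : |m| ≤ N)
    {z : ℝ × EuclideanSpace ℝ (Fin d)} (hz : z ∈ focalRegion d N) {ξ : EuclideanSpace ℝ (Fin d)}
    (hξ : ‖ξ‖ ≤ 2 * N) (hγ : |√(‖ξ‖ ^ 2 + m ^ 2) - γ| ≤ 1 / 2) :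
    |inner ℝ z.2 ξ + z.1 * √(‖ξ‖ ^ 2 + m ^ 2) - γ - 0| ≤ 1 := by
  obtain ⟨⟨ht1, ht2⟩, hx⟩ := hz
  rw [mem_ball_zero_iff] at hx
  have hN0 : 0 < N := by linarith
  set φ := √(‖ξ‖ ^ 2 + m ^ 2) with hφ
  have hφ0 : 0 ≤ φ := Real.sqrt_nonneg _
  have hφN : φ ≤ 3 * N := by
    refine Real.sqrt_le_iff.2 ⟨by positivity, ?_⟩
    have h1 : ‖ξ‖ ^ 2 ≤ (2 * N) ^ 2 := by gcongr
    have h2 : m ^ 2 ≤ N ^ 2 := sq_le_sq' (abs_le.1 hm).1 (abs_le.1 hm).2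
    nlinarith
  have h1 : |inner ℝ z.2 ξ| ≤ 1 / 8 := by
    calc |inner ℝ z.2 ξ| ≤ ‖z.2‖ * ‖ξ‖ := abs_real_inner_le_norm _ _
      _ ≤ 1 / (16 * N) * (2 * N) := by gcongr
      _ = 1 / 8 := by field_simp; norm_num
  have h2 : (1 - z.1) * φ ≤ 3 / 20 := by
    calc (1 - z.1) * φ ≤ 1 / (20 * N) * (3 * N) := by
          gcongr
          linarith
      _ = 3 / 20 := by field_simp
  have h3 : 0 ≤ (1 - z.1) * φ := mul_nonneg (by linarith) hφ0
  rw [abs_le] at h1 hγ ⊢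
  constructor <;> linarith [h1.1, h1.2, hγ.1, hγ.2]

theorem norm_le_of_abs_apply_le {d : ℕ} {y : EuclideanSpace ℝ (Fin d)} {ε : ℝ} (hε : 0 ≤ ε)
    (h : ∀ i, |y i| ≤ ε) : ‖y‖ ≤ d * ε := by
  rcases Nat.eq_zero_or_pos d with rfl | hd
  · rw [Subsingleton.elim y 0]; simp
  refine le_of_sq_le_sq ?_ (by positivity)
  rw [EuclideanSpace.real_norm_sq_eq]
  calc ∑ i, y i ^ 2 ≤ ∑ _i : Fin d, ε ^ 2 :=
        Finset.sum_le_sum fun i _ => sq_le_sq' (abs_le.1 (h i)).1 (abs_le.1 (h i)).2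
    _ = d * ε ^ 2 := by simp
    _ ≤ d * (d * ε ^ 2) := by
        refine le_mul_of_one_le_left (by positivity) ?_
        exact_mod_cast hd
    _ = (d * ε) ^ 2 := by ring

/-- The comparison of exponents in the packet bound for `R ^ q` packets at frequency `N = R ^ 2`,
when the product of the volume of the focal set and the determinant of the packets is `κ R ^ z`. -/
theorem exponent_le_of_forall_large {κ C p s q z : ℝ} (hκ : 0 < κ)
    (l₀ : ℕ) (h : ∀ l : ℕ, l₀ ≤ l →
      ((2 : ℝ) ^ l) ^ q * (κ * ((2 : ℝ) ^ l) ^ z) ^ (1 / p) ≤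
        C * (((2 : ℝ) ^ l) ^ 2) ^ s * (((2 : ℝ) ^ l) ^ q) ^ (1 / p)) :
    q + z / p ≤ 2 * s + q / p := by
  by_contra! hlt
  set u := q + z / p - (2 * s + q / p) with hu
  have hu0 : 0 < u := by linarith
  have hlim : Filter.Tendsto (fun l : ℕ => ((2 : ℝ) ^ l) ^ u) Filter.atTop Filter.atTop :=
    (tendsto_rpow_atTop hu0).comp (tendsto_pow_atTop_atTop_of_one_lt one_lt_two)
  obtain ⟨l, hl, hl'⟩ := ((hlim.eventually_gt_atTop (C / κ ^ (1 / p))).and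
    (Filter.eventually_ge_atTop l₀)).exists
  have hR : 0 < (2 : ℝ) ^ l := by positivity
  have hκp : 0 < κ ^ (1 / p) := Real.rpow_pos_of_pos hκ _
  have key := h l hl'
  set R := (2 : ℝ) ^ l with hRdef
  rw [Real.mul_rpow hκ.le (by positivity), ← Real.rpow_natCast R 2, ← Real.rpow_mul hR.le,
    ← Real.rpow_mul hR.le, ← Real.rpow_mul hR.le, mul_one_div, mul_one_div, mul_assoc C,
    ← Real.rpow_add hR, mul_left_comm, ← Real.rpow_add hR] at key
  rw [div_lt_iff₀ hκp] at hl
  have hB : 0 < R ^ (2 * s + q / p) := Real.rpow_pos_of_pos hR _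
  have h2 : R ^ (q + z / p) = R ^ u * R ^ (2 * s + q / p) := by
    rw [← Real.rpow_add hR, hu]
    congr 1
    ring
  rw [h2] at key
  push_cast at key
  have := mul_lt_mul_of_pos_right hl hB
  nlinarith

/-- At mass `R ^ 2`, the phase is affine up to `O(1)` on the ball of radius about `R` around the
frequency of velocity `w`. -/
theorem abs_sqrt_sub_tangent_le_of_mass {d : ℕ} {w y : EuclideanSpace ℝ (Fin d)} {R : ℝ}
    (hR : 1 ≤ R) (hw : ‖w‖ ^ 2 < 1) (hy : ‖y‖ ≤ 1 / 2) {ξ : EuclideanSpace ℝ (Fin d)}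
    (hξ : ξ = R ^ 2 • (√(1 - ‖w‖ ^ 2))⁻¹ • w + R • y) :
    |√(‖ξ‖ ^ 2 + (R ^ 2) ^ 2) - (R ^ 2 * √(1 - ‖w‖ ^ 2) + inner ℝ w ξ)| ≤ 1 / 2 := by
  have hR0 : 0 < R := by linarith
  set q := √(1 - ‖w‖ ^ 2) with hq
  have hq0 : 0 < q := Real.sqrt_pos.2 (by linarith)
  have hq2 : q ^ 2 = 1 - ‖w‖ ^ 2 := Real.sq_sqrt (by linarith)
  have hq1 : q ≤ 1 := by nlinarith [sq_nonneg ‖w‖]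
  have hinv : 1 ≤ q⁻¹ := (one_le_inv₀ hq0).2 hq1
  have hwy : |inner ℝ w y| ≤ ‖y‖ := by
    refine (abs_real_inner_le_norm _ _).trans (mul_le_of_le_one_left (norm_nonneg _) ?_)
    nlinarith [norm_nonneg w]
  have hw2 : ‖w‖ ^ 2 = 1 - q ^ 2 := by linarith
  have hγ : R ^ 2 * q + inner ℝ w ξ = R ^ 2 * q⁻¹ + R * inner ℝ w y := by
    rw [hξ, inner_add_right, real_inner_smul_right, real_inner_smul_right,
      real_inner_smul_right, real_inner_self_eq_norm_sq, hw2]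
    field_simp
    ring
  have hξ2 : ‖ξ‖ ^ 2 + (R ^ 2) ^ 2 =
      (R ^ 2 * q⁻¹ + R * inner ℝ w y) ^ 2 + R ^ 2 * (‖y‖ ^ 2 - inner ℝ w y ^ 2) := by
    rw [hξ, norm_add_sq_real, norm_smul, norm_smul, norm_smul, real_inner_smul_left,
      real_inner_smul_left, real_inner_smul_right, Real.norm_of_nonneg hR0.le,
      Real.norm_of_nonneg (by positivity : 0 ≤ R ^ 2),
      Real.norm_of_nonneg (by positivity : 0 ≤ q⁻¹), mul_pow, mul_pow, mul_pow, hw2]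
    field_simp
    ring
  have hsq : inner ℝ w y ^ 2 ≤ ‖y‖ ^ 2 := sq_le_sq' (abs_le.1 hwy).1 (abs_le.1 hwy).2
  rw [hγ]
  refine abs_sub_le_of_abs_sq_sub_sq_le (X := R ^ 2) (by positivity)
    (Real.le_sqrt_of_sq_le (by nlinarith [sq_nonneg ‖ξ‖])) ?_ ?_
  · have h1 : R ^ 2 * 1 ≤ R ^ 2 * q⁻¹ := by gcongr
    have h2 : R * |inner ℝ w y| ≤ R * 1 := by
      gcongr
      linarith
    have h3 := mul_le_mul_of_nonneg_left (neg_abs_le (inner ℝ w y)) hR0.le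
    nlinarith
  · rw [Real.sq_sqrt (by positivity), hξ2, add_sub_cancel_left,
      abs_of_nonneg (mul_nonneg (by positivity) (by linarith)), mul_comm]
    refine mul_le_mul_of_nonneg_right ?_ (by positivity)
    have := sq_nonneg (inner ℝ w y)
    nlinarith [norm_nonneg y]

/-- At bounded mass, the phase is linear up to `O(1)` on the plate of dimensions about
`R ^ 2 × R × ⋯ × R` around a frequency of size about `R ^ 2` in the direction `θ`. -/
theorem abs_sqrt_sub_inner_le_of_plate {d : ℕ} {θ y : EuclideanSpace ℝ (Fin d)} {R c m : ℝ}
    {A : EuclideanSpace ℝ (Fin d) ≃L[ℝ] EuclideanSpace ℝ (Fin d)} (hθ : ‖θ‖ = 1)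
    (hA : ∀ x, A x = R • x + ((R ^ 2 - R) * inner ℝ θ x) • θ)
    (hR : 1 ≤ R) (hm : 4 * m ^ 2 ≤ R ^ 2) (hc : 1 ≤ c) (hy : ‖y‖ ≤ 1 / 2)
    {ξ : EuclideanSpace ℝ (Fin d)} (hξ : ξ = (c * R ^ 2) • θ + A y) (hξR : R ^ 2 ≤ ‖ξ‖) :
    |√(‖ξ‖ ^ 2 + m ^ 2) - inner ℝ θ ξ| ≤ 1 / 2 := by
  have hR0 : 0 < R := by linarith
  have hθy : |inner ℝ θ y| ≤ ‖y‖ := by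
    have := abs_real_inner_le_norm θ y
    rwa [hθ, one_mul] at this
  have hsq := inner_sq_le_norm_sq hθ y
  have hγ : inner ℝ θ ξ = R ^ 2 * (c + inner ℝ θ y) := by
    rw [hξ, inner_add_right, real_inner_smul_right, real_inner_self_eq_norm_sq, hθ,
      inner_stretch hθ hA]
    ring
  have hξ2 : ‖ξ‖ ^ 2 = (R ^ 2 * (c + inner ℝ θ y)) ^ 2 +
      R ^ 2 * (‖y‖ ^ 2 - inner ℝ θ y ^ 2) := by
    rw [hξ, norm_add_sq_real, norm_smul, hθ, mul_one, Real.norm_of_nonneg (by positivity),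
      norm_stretch_sq hθ hA, real_inner_smul_left, inner_stretch hθ hA]
    ring
  rw [hγ]
  refine abs_sub_le_of_abs_sq_sub_sq_le (X := R ^ 2) (by positivity)
    (hξR.trans (Real.le_sqrt_of_sq_le (by nlinarith [sq_nonneg m]))) ?_ ?_
  · have := neg_abs_le (inner ℝ θ y)
    exact mul_nonneg (by positivity) (by linarith)
  · have h1 : 0 ≤ R ^ 2 * (‖y‖ ^ 2 - inner ℝ θ y ^ 2) :=
      mul_nonneg (by positivity) (by linarith)
    rw [Real.sq_sqrt (by positivity), hξ2, add_assoc, add_sub_cancel_left,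
      abs_of_nonneg (by positivity)]
    have h2 : ‖y‖ ^ 2 - inner ℝ θ y ^ 2 ≤ 1 / 4 := by
      have := sq_nonneg (inner ℝ θ y)
      nlinarith [norm_nonneg y]
    have h3 : R ^ 2 * (‖y‖ ^ 2 - inner ℝ θ y ^ 2) ≤ R ^ 2 * (1 / 4) := by gcongr
    linarith

/-- Points of the upper unit hemisphere with prescribed horizontal coordinates. -/
theorem exists_norm_eq_one_of_sum_sq_le {d : ℕ} (i₀ : Fin d) {u : {i : Fin d // i ≠ i₀} → ℝ}
    (hu : ∑ i, u i ^ 2 ≤ 1) :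
    ∃ θ : EuclideanSpace ℝ (Fin d), ‖θ‖ = 1 ∧ ∀ i : {i : Fin d // i ≠ i₀}, θ i = u i := by
  set θ : EuclideanSpace ℝ (Fin d) := WithLp.toLp 2 fun i =>
    if hi : i = i₀ then √(1 - ∑ i, u i ^ 2) else u ⟨i, hi⟩ with hθ
  have hθi : ∀ i : {i : Fin d // i ≠ i₀}, θ i = u i := by
    intro i
    simp only [hθ]
    rw [dif_neg i.2]
  refine ⟨θ, ?_, hθi⟩
  rw [← sq_eq_sq₀ (norm_nonneg _) zero_le_one, one_pow, EuclideanSpace.real_norm_sq_eq,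
    Fintype.sum_eq_add_sum_subtype_ne _ i₀]
  simp_rw [hθi]
  have : θ i₀ = √(1 - ∑ i, u i ^ 2) := by simp [hθ]
  rw [this, Real.sq_sqrt (by linarith)]
  ring

theorem rpow_packet_volume {R κ : ℝ} (hR : 0 < R) (n d : ℕ) :
    R ^ n * (κ * ((R ^ 2) ^ (d + 1))⁻¹) = κ * R ^ ((n : ℝ) - 2 * (d + 1)) := by
  rw [Real.rpow_sub hR, Real.rpow_natCast,
    show (2 : ℝ) * (d + 1) = ((2 * (d + 1) : ℕ) : ℝ) by push_cast; ring, Real.rpow_natCast,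
    pow_mul]
  ring

/-! ### The three test functions -/

section Necessity

variable {d : ℕ} {χ₀ : EuclideanSpace ℝ (Fin d) → ℝ} {p s : ℝ} {M : Set ℝ}

/-- A single packet of unit scale at frequency about `N` moves without dispersing. -/
theorem LocalSmoothing.nonneg (hd : 1 ≤ d) (hχ₀ : IsRadialCutoff χ₀) (hp : 1 ≤ p)
    (hM : M.Nonempty) (h : LocalSmoothing χ₀ p s M) : 0 ≤ s := by
  obtain ⟨m, hm⟩ := hM
  obtain ⟨c, δ, hδ, hc1, hc2, hcut⟩ := hχ₀.exists_dyadicCutoff_eq_one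
  let β : ContDiffBump (0 : EuclideanSpace ℝ (Fin d)) := ⟨δ / 4, δ / 2, by linarith, by linarith⟩
  -- an empty index type of velocity coordinates gives a single packet
  obtain ⟨C, hC⟩ := h.exists_packet_bound hp β (ι := Empty) Empty.elim Empty.elim one_pos
  set V := (volume (Metric.ball (0 : EuclideanSpace ℝ (Fin d)) 1)).toReal with hV
  have hV0 : 0 < V :=
    ENNReal.toReal_pos (Metric.measure_ball_pos _ _ one_pos).ne' measure_ball_lt_top.ne
  set θ : EuclideanSpace ℝ (Fin d) := EuclideanSpace.single ⟨0, hd⟩ 1 with hθ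
  have hθ1 : ‖θ‖ = 1 := by simp [hθ]
  have key := exponent_le_of_forall_large (κ := V) (C := C) (p := p) (s := s) (q := 0) (z := 0)
    hV0 0 fun l _ => by
      set N : ℝ := 2 ^ (2 * l) with hN
      have hN1 : 1 ≤ N := one_le_pow₀ one_le_two
      have hξ₀ : ‖(c * N) • θ‖ = c * N := by
        rw [norm_smul, hθ1, mul_one, Real.norm_of_nonneg (by nlinarith)]
      have := hC (2 * l) m hm 1 1 1 V one_pos one_pos hV0.le
        (fun _ => ContinuousLinearEquiv.refl ℝ _) (fun _ => (c * N) • θ) (fun _ => 0) (fun _ => 0)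
        (Set.Icc 0 1 ×ˢ Metric.ball 0 1) (fun _ _ _ => rfl) (fun _ => LinearMap.det_id)
        (fun _ y => by simp) (fun _ i => i.elim)
        (measurableSet_Icc.prod measurableSet_ball)
        (Set.prod_mono_right (Set.subset_univ _))
        (by
          rw [Measure.volume_eq_prod, Measure.prod_prod, Real.volume_Icc, hV,
            ENNReal.ofReal_toReal measure_ball_lt_top.ne]
          simp)
        (fun _ ξ hξ => by
          refine hcut N ξ (by linarith) ?_
          change ‖ξ - (c * N) • θ‖ < δ / 2 at hξ
          have := abs_norm_sub_norm_le ξ ((c * N) • θ)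
          rw [hξ₀] at this
          nlinarith)
        (fun z hz => by
          -- the common phase is that of the plane wave at the centre of the packet
          refine ⟨inner ℝ z.2 ((c * N) • θ) + z.1 * √(‖(c * N) • θ‖ ^ 2 + m ^ 2),
            fun _ ξ hξ => ?_⟩
          change ‖ξ - (c * N) • θ‖ < δ / 2 at hξ
          obtain ⟨⟨ht0, ht1⟩, hx⟩ := hz
          rw [mem_ball_zero_iff] at hx
          have h1 := abs_sqrt_norm_sq_add_sub_le m ξ ((c * N) • θ) (by rw [hξ₀]; nlinarith)
          have h2 : |inner ℝ z.2 (ξ - (c * N) • θ)| ≤ 1 * ‖ξ - (c * N) • θ‖ :=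
            (abs_real_inner_le_norm _ _).trans (by gcongr)
          have h3 : |z.1 * (√(‖ξ‖ ^ 2 + m ^ 2) - √(‖(c * N) • θ‖ ^ 2 + m ^ 2))| ≤
              1 * ‖ξ - (c * N) • θ‖ := by
            rw [abs_mul, abs_of_nonneg ht0]
            gcongr
          have h4 := (abs_add_le _ _).trans (add_le_add h2 h3)
          rw [inner_sub_right] at h4
          rw [inner_zero_left]
          refine le_trans (le_of_eq ?_) (h4.trans (by linarith))
          congr 1
          ring)
      simp only [Fintype.card_empty, pow_zero, one_mul, Real.one_rpow, mul_one] at this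
      simp only [Real.rpow_zero, mul_one, one_mul, Real.one_rpow, ← pow_mul, mul_comm l 2]
      exact this
  simp only [zero_div, add_zero] at key
  linarith

/-- For masses comparable to the frequency the map from frequency to velocity is a local
diffeomorphism; packets with all velocities in a small cube focus at time `1`. -/
theorem LocalSmoothing.le_of_large_masses (hd : 1 ≤ d) (hχ₀ : IsRadialCutoff χ₀) (hp : 1 ≤ p)
    (h : LocalSmoothing χ₀ p s M) (hM : ∀ l : ℕ, (2 : ℝ) ^ (2 * l) ∈ M) :
    (d : ℝ) * (1 / 2 - 1 / p) - 1 / p ≤ s := by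
  obtain ⟨c, δ, hδ, hc1, hc2, hcut⟩ := hχ₀.exists_dyadicCutoff_eq_one
  obtain ⟨κ, hκ, hvol⟩ := exists_volume_focalRegion d
  let β : ContDiffBump (0 : EuclideanSpace ℝ (Fin d)) := ⟨δ / 4, δ / 2, by linarith, by linarith⟩
  set θ : EuclideanSpace ℝ (Fin d) := EuclideanSpace.single ⟨0, hd⟩ 1 with hθ
  have hθ1 : ‖θ‖ = 1 := by simp [hθ]
  -- the frequency of velocity `w` is `m • G w`; `w₀` is the velocity with `G w₀ = c • θ`
  set G : EuclideanSpace ℝ (Fin d) → EuclideanSpace ℝ (Fin d) :=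
    fun w => (√(1 - ‖w‖ ^ 2))⁻¹ • w with hG
  set w₀ : EuclideanSpace ℝ (Fin d) := (c / √(1 + c ^ 2)) • θ with hw₀
  have hc0 : 0 < c := by linarith
  have hw₀n : ‖w₀‖ ^ 2 = c ^ 2 / (1 + c ^ 2) := by
    rw [hw₀, norm_smul, hθ1, mul_one, Real.norm_of_nonneg (by positivity), div_pow,
      Real.sq_sqrt (by positivity)]
  have hw₀q : 1 - ‖w₀‖ ^ 2 = (1 + c ^ 2)⁻¹ := by
    rw [hw₀n]
    field_simp
    ring
  have hGw₀ : G w₀ = c • θ := by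
    simp only [hG]
    rw [hw₀q, Real.sqrt_inv, inv_inv, hw₀, smul_smul]
    congr 1
    field_simp
  have hGc : ContinuousAt G w₀ := by
    simp only [hG]
    have hne : √(1 - ‖w₀‖ ^ 2) ≠ 0 := by
      rw [hw₀q]
      positivity
    have hc : ContinuousAt (fun w : EuclideanSpace ℝ (Fin d) => √(1 - ‖w‖ ^ 2)) w₀ := by fun_prop
    exact (hc.inv₀ hne).smul continuousAt_id
  have hev : ∀ᶠ w in nhds w₀, ‖G w - c • θ‖ < δ / 2 ∧ ‖w‖ ^ 2 < 1 := by
    refine Filter.Eventually.and ?_ ?_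
    · have := hGc.eventually (Metric.ball_mem_nhds _ (half_pos hδ))
      rw [hGw₀] at this
      simpa [dist_eq_norm] using this
    · refine ContinuousAt.eventually_lt (by fun_prop) continuousAt_const ?_
      rw [hw₀n, div_lt_one (by positivity)]
      linarith
  obtain ⟨η, hη, hball⟩ := Metric.eventually_nhds_iff.1 hev
  have hd0 : (0 : ℝ) < d := by exact_mod_cast hd
  have hε : 0 < η / (2 * d) := by positivity
  -- this spacing keeps all velocities within distance `η` of `w₀`
  set ε := η / (2 * d) with hεdef
  obtain ⟨C, hC⟩ := h.exists_packet_bound hp β (ι := Fin d) id (fun i => w₀ i) hε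
  have key := exponent_le_of_forall_large (κ := κ) (C := C) (p := p) (s := s) (q := d)
    (z := d - 2 * (d + 1)) hκ 0 fun l _ => by
      set R : ℝ := 2 ^ l with hR
      have hR1 : 1 ≤ R := one_le_pow₀ one_le_two
      have hR0 : 0 < R := by linarith
      have hN : (2 : ℝ) ^ (2 * l) = R ^ 2 := by rw [hR, ← pow_mul, mul_comm]
      have hN1 : 1 ≤ R ^ 2 := one_le_pow₀ hR1
      have hRN : R ≤ R ^ 2 := by nlinarith
      obtain ⟨A, hA, hdet⟩ := exists_stretch hθ1 hR0 hR0
      have hAR : ∀ y, A y = R • y := fun y => by rw [hA]; simp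
      set w : (Fin d → Fin (2 ^ l)) → EuclideanSpace ℝ (Fin d) :=
        fun j => WithLp.toLp 2 fun i => w₀ i + ε * ((j i : ℕ) : ℝ) / R with hw
      have hww₀ : ∀ j, dist (w j) w₀ < η := by
        intro j
        rw [dist_eq_norm]
        have : ‖w j - w₀‖ ≤ d * ε := by
          refine norm_le_of_abs_apply_le hε.le fun i => ?_
          have h1 : (w j - w₀) i = ε * (((j i : ℕ) : ℝ) / R) := by
            simp only [hw, PiLp.sub_apply]
            ring
          have h2 : ((j i : ℕ) : ℝ) / R ≤ 1 := by
            rw [div_le_one hR0, hR]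
            exact_mod_cast (j i).2.le
          rw [h1, abs_of_nonneg (by positivity)]
          exact mul_le_of_le_one_right hε.le h2
        refine this.trans_lt ?_
        rw [hεdef]
        field_simp
        linarith
      -- the frequencies of a packet, described in the coordinates `y` adapted to it
      have hfreq : ∀ j ξ, ‖A.symm (ξ - R ^ 2 • G (w j))‖ < β.rOut →
          |‖ξ‖ - c * R ^ 2| ≤ δ * R ^ 2 ∧
          |√(‖ξ‖ ^ 2 + (R ^ 2) ^ 2) - (R ^ 2 * √(1 - ‖w j‖ ^ 2) + inner ℝ (w j) ξ)| ≤ 1 / 2 := by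
        intro j ξ hξ
        obtain ⟨hGj, hwj⟩ := hball (hww₀ j)
        set y := A.symm (ξ - R ^ 2 • G (w j)) with hy
        change ‖y‖ < δ / 2 at hξ
        have hξy : ξ = R ^ 2 • G (w j) + R • y := by
          rw [← hAR, hy, A.apply_symm_apply]
          abel
        have hδ2 : δ ≤ 1 / 2 := by linarith
        have hcθ : ‖(c * R ^ 2) • θ‖ = c * R ^ 2 := by
          rw [norm_smul, hθ1, mul_one, Real.norm_of_nonneg (by positivity)]
        refine ⟨?_, ?_⟩
        · rw [← hcθ]
          refine (abs_norm_sub_norm_le _ _).trans ?_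
          have h1 : ξ - (c * R ^ 2) • θ = R ^ 2 • (G (w j) - c • θ) + R • y := by
            rw [hξy, mul_comm c, mul_smul, smul_sub]
            abel
          rw [h1]
          refine (norm_add_le _ _).trans ?_
          rw [norm_smul, norm_smul, Real.norm_of_nonneg hR0.le,
            Real.norm_of_nonneg (by positivity)]
          have h2 : R ^ 2 * ‖G (w j) - c • θ‖ ≤ R ^ 2 * (δ / 2) := by gcongr
          have h3 : R * ‖y‖ ≤ R ^ 2 * (δ / 2) := by gcongr
          linarith
        · exact abs_sqrt_sub_tangent_le_of_mass hR1 hwj (by linarith) hξy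
      have := hC (2 * l) (2 ^ (2 * l)) (hM l) (2 ^ l) R (R ^ d) (κ * ((R ^ 2) ^ (d + 1))⁻¹)
        hR0 (by positivity) (by positivity) (fun _ => A) (fun j => R ^ 2 • G (w j)) w
        (fun j => R ^ 2 * √(1 - ‖w j‖ ^ 2)) (focalRegion d (R ^ 2))
        (fun _ => inner_stretch_comm hA) (fun _ => by rw [hdet, div_self hR0.ne', mul_one])
        (fun _ => le_norm_stretch hθ1 hR0 le_rfl hA) (fun j i => rfl)
        (measurableSet_focalRegion _ _) (focalRegion_subset hN1) (hvol _ hN1)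
        (fun j ξ hξ => by
          rw [hN]
          exact hcut _ _ (by positivity) (hfreq j ξ hξ).1)
        (fun z hz => ⟨0, fun j ξ hξ => by
          obtain ⟨h1, h2⟩ := hfreq j ξ hξ
          rw [hN]
          refine abs_phase_le_of_mem_focalRegion hN1 (abs_of_nonneg (by positivity)).le hz ?_ h2
          have := (abs_le.1 h1).2
          nlinarith⟩)
      rw [Fintype.card_fin, hN] at this
      push_cast at this
      rw [← hR] at this
      rw [Real.rpow_natCast]
      rwa [← rpow_packet_volume hR0]
  have hp0 : 0 < p := by linarith
  have : (d : ℝ) * (1 / 2 - 1 / p) - 1 / p =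
      ((d + (d - 2 * (d + 1)) / p) - d / p) / 2 := by
    field_simp
    ring
  rw [this]
  linarith

/-- For a fixed mass the velocities at high frequency are unit vectors up to negligible errors;
packets with all directions in a small cap, elongated in frequency along their direction, focus at
time `1`. -/
theorem LocalSmoothing.le_of_mem (hd : 1 ≤ d) (hχ₀ : IsRadialCutoff χ₀) (hp : 1 ≤ p)
    (h : LocalSmoothing χ₀ p s M) {m : ℝ} (hm : m ∈ M) :
    ((d : ℝ) - 1) * (1 / 2 - 1 / p) - 1 / p ≤ s := by
  obtain ⟨c, δ, hδ, hc1, hc2, hcut⟩ := hχ₀.exists_dyadicCutoff_eq_one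
  obtain ⟨κ, hκ, hvol⟩ := exists_volume_focalRegion d
  let β : ContDiffBump (0 : EuclideanSpace ℝ (Fin d)) := ⟨δ / 4, δ / 2, by linarith, by linarith⟩
  have hc0 : 0 < c := by linarith
  have hd0 : (0 : ℝ) < d := by exact_mod_cast hd
  set i₀ : Fin d := ⟨0, hd⟩ with hi₀
  have hε : 0 < 1 / (d : ℝ) := by positivity
  -- this spacing keeps the horizontal parts of all directions in the unit ball
  set ε := 1 / (d : ℝ) with hεdef
  obtain ⟨C, hC⟩ := h.exists_packet_bound hp β (ι := {i : Fin d // i ≠ i₀}) Subtype.val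
    (fun _ => 0) hε
  have hcard : Fintype.card {i : Fin d // i ≠ i₀} = d - 1 := by
    simp
  obtain ⟨l₀, hl₀⟩ : ∃ l₀ : ℕ, 4 * m ^ 2 + 1 < (2 : ℝ) ^ l₀ :=
    pow_unbounded_of_one_lt _ one_lt_two
  have key := exponent_le_of_forall_large (κ := κ) (C := C) (p := p) (s := s)
    (q := (d : ℝ) - 1) (z := d + 1 - 2 * (d + 1)) hκ l₀ fun l hl => by
      set R : ℝ := 2 ^ l with hR
      have hR1 : 1 ≤ R := one_le_pow₀ one_le_two
      have hR0 : 0 < R := by linarith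
      have hN : (2 : ℝ) ^ (2 * l) = R ^ 2 := by rw [hR, ← pow_mul, mul_comm]
      have hN1 : 1 ≤ R ^ 2 := one_le_pow₀ hR1
      have hRN : R ≤ R ^ 2 := by nlinarith
      have hmR : 4 * m ^ 2 + 1 ≤ R ^ 2 :=
        (hl₀.le.trans (pow_le_pow_right₀ one_le_two hl)).trans hRN
      have hmN : |m| ≤ R ^ 2 := by
        rw [abs_le]
        constructor <;> nlinarith [sq_nonneg (2 * m - 1), sq_nonneg (2 * m + 1)]
      set u : ({i : Fin d // i ≠ i₀} → Fin (2 ^ l)) → {i : Fin d // i ≠ i₀} → ℝ :=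
        fun j i => ε * ((j i : ℕ) : ℝ) / R with hu
      have hu1 : ∀ j, ∑ i, u j i ^ 2 ≤ 1 := by
        intro j
        calc ∑ i, u j i ^ 2 ≤ ∑ _i : {i : Fin d // i ≠ i₀}, ε ^ 2 := by
              refine Finset.sum_le_sum fun i _ => ?_
              have h2 : ((j i : ℕ) : ℝ) / R ≤ 1 := by
                rw [div_le_one hR0, hR]
                exact_mod_cast (j i).2.le
              simp only [hu]
              rw [mul_div_assoc, mul_pow]
              exact mul_le_of_le_one_right (by positivity) (pow_le_one₀ (by positivity) h2)
          _ = (d - 1 : ℕ) * ε ^ 2 := by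
              rw [Finset.sum_const, Finset.card_univ, hcard, nsmul_eq_mul]
          _ ≤ d * ε ^ 2 := by
              gcongr
              exact Nat.sub_le _ _
          _ = ε := by rw [hεdef]; field_simp
          _ ≤ 1 := by
              rw [hεdef, div_le_one hd0]
              exact_mod_cast hd
      choose θ hθ1 hθi using fun j => exists_norm_eq_one_of_sum_sq_le i₀ (hu1 j)
      have hstr := fun j => exists_stretch (hθ1 j) hR0 (by positivity : 0 < R ^ 2)
      choose A hA hdet using hstr
      -- the frequencies of a packet, described in the coordinates `y` adapted to it
      have hfreq : ∀ j ξ, ‖(A j).symm (ξ - (c * R ^ 2) • θ j)‖ < β.rOut →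
          |‖ξ‖ - c * R ^ 2| ≤ δ * R ^ 2 ∧
          |√(‖ξ‖ ^ 2 + m ^ 2) - (0 + inner ℝ (θ j) ξ)| ≤ 1 / 2 := by
        intro j ξ hξ
        set y := (A j).symm (ξ - (c * R ^ 2) • θ j) with hy
        change ‖y‖ < δ / 2 at hξ
        have hξy : ξ = (c * R ^ 2) • θ j + A j y := by
          rw [hy, (A j).apply_symm_apply]
          abel
        have hδ2 : δ ≤ 1 / 2 := by linarith
        have hcθ : ‖(c * R ^ 2) • θ j‖ = c * R ^ 2 := by
          rw [norm_smul, hθ1, mul_one, Real.norm_of_nonneg (by positivity)]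
        have hann : |‖ξ‖ - c * R ^ 2| ≤ δ * R ^ 2 := by
          rw [← hcθ]
          refine (abs_norm_sub_norm_le _ _).trans ?_
          rw [hξy, add_sub_cancel_left]
          refine (norm_stretch_le (hθ1 j) hR0 hRN (hA j) y).trans ?_
          rw [mul_comm]
          gcongr
          linarith
        have hξN : R ^ 2 ≤ ‖ξ‖ := by
          have := (abs_le.1 hann).1
          nlinarith
        rw [zero_add]
        exact ⟨hann, abs_sqrt_sub_inner_le_of_plate (hθ1 j) (hA j) hR1 (by linarith)
          (by linarith) (by linarith) hξy hξN⟩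
      have := hC (2 * l) m hm (2 ^ l) R (R ^ (d + 1)) (κ * ((R ^ 2) ^ (d + 1))⁻¹)
        hR0 (by positivity) (by positivity) A (fun j => (c * R ^ 2) • θ j) θ
        (fun _ => 0) (focalRegion d (R ^ 2))
        (fun j => inner_stretch_comm (hA j))
        (fun j => by
          rw [hdet]
          field_simp
          exact (pow_succ R d).symm)
        (fun j => le_norm_stretch (hθ1 j) hR0 hRN (hA j))
        (fun j i => by rw [hθi, zero_add])
        (measurableSet_focalRegion _ _) (focalRegion_subset hN1) (hvol _ hN1)
        (fun j ξ hξ => by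
          rw [hN]
          exact hcut _ _ (by positivity) (hfreq j ξ hξ).1)
        (fun z hz => ⟨0, fun j ξ hξ => by
          obtain ⟨h1, h2⟩ := hfreq j ξ hξ
          refine abs_phase_le_of_mem_focalRegion hN1 hmN hz ?_ h2
          have := (abs_le.1 h1).2
          nlinarith⟩)
      rw [hcard, hN] at this
      push_cast at this
      rw [← hR] at this
      have hq : R ^ ((d : ℝ) - 1) = R ^ (d - 1) := by
        rw [← Real.rpow_natCast, Nat.cast_sub hd, Nat.cast_one]
      rw [hq]
      rwa [show (d : ℝ) + 1 - 2 * (d + 1) = ((d + 1 : ℕ) : ℝ) - 2 * (d + 1) by push_cast; ring,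
        ← rpow_packet_volume hR0]
  have hp0 : 0 < p := by linarith
  have : ((d : ℝ) - 1) * (1 / 2 - 1 / p) - 1 / p =
      ((((d : ℝ) - 1) + (d + 1 - 2 * (d + 1)) / p) - ((d : ℝ) - 1) / p) / 2 := by
    field_simp
    ring
  rw [this]
  linarith

end Necessity

end KleinGordon

theorem mainTheorem7 (d : ℕ) (hd : 1 ≤ d) (χ₀ : EuclideanSpace ℝ (Fin d) → ℝ)
    (hχ₀ : KleinGordon.IsRadialCutoff χ₀) (p : ℝ) (hp : 2 ≤ p) (s : ℝ) :
    (KleinGordon.LocalSmoothing χ₀ p s KleinGordon.masses →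
      max ((d : ℝ) * (1 / 2 - 1 / p) - 1 / p) 0 ≤ s) ∧
    (∀ m₀ : ℝ, ∀ M : Set ℝ, M.Nonempty → M ⊆ KleinGordon.masses ∩ Set.Iic m₀ →
      KleinGordon.LocalSmoothing χ₀ p s M →
      max (((d : ℝ) - 1) * (1 / 2 - 1 / p) - 1 / p) 0 ≤ s) := by
  have hp1 : 1 ≤ p := by linarith
  refine ⟨fun h => max_le (h.le_of_large_masses hd hχ₀ hp1 fun l => ?_)
    (h.nonneg hd hχ₀ hp1 ⟨0, Or.inl rfl⟩), fun m₀ M hM _ h => ?_⟩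
  · exact Or.inr ⟨((2 * l : ℕ) : ℤ), (zpow_natCast _ _).symm⟩
  · obtain ⟨m, hm⟩ := hM
    exact max_le (h.le_of_mem hd hχ₀ hp1 hm) (h.nonneg hd hχ₀ hp1 ⟨m, hm⟩)
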